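/- Let $\Delta=\{\zeta\in\mathbb C : |\zeta|<1\}$, let $\Delta^n\subset\mathbb C^n$ be the polydisk, i.e. the open unit ball of the norm $\|z\|=\max_j|z_j|$, and let $k_{\Delta^n}$ be its Kobayashi distance, i.e. the largest pseudodistance on $\Delta^n$ bounded above by the Lempert function $$\delta_{\Delta^n}(z,w)=\inf\{k_\Delta(\zeta,\eta) : \text{there is a holomorphic } \varphi\colon\Delta\to\Delta^n \text{ with } \varphi(\zeta)=z,\ \varphi(\eta)=w\},$$ where $k_\Delta(\zeta,\eta)=\frac12\log\frac{1+\rho}{1-\rho}$, $\rho=\left|\frac{\eta-\zeta}{1-\bar\zeta\eta}\right|$, is the Poincaré distance of $\Delta$. For a map $f\colon\Delta^n\to\Delta^n$, a map $h\colon\Delta^n\to\mathbb C^n$ is called a limit point of the sequence of iterates $\{f^k\}$ if some subsequence $\{f^{k_j}\}$ converges to $h$ uniformly on compact subsets of $\Delta^n$; the target set $T(f)$ is the union of the images $h(\Delta^n)$ over all limit points $h$ of $\{f^k\}$. **Corollary 4.1.** Let $f\colon\Delta^n\to\Delta^n$ be a self-map without fixed points which is $k_{\Delta^n}$-nonexpansive,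 i.e. $k_{\Delta^n}(f(z),f(w))\le k_{\Delta^n}(z,w)$ for all $z,w\in\Delta^n$ (for example, a holomorphic self-map). Then there exists $\xi\in\partial\Delta^n$ such that $$T(f)\subseteq\bigcup_{j=1}^n\overline\Delta\times\cdots\times C_j(\xi)\times\cdots\times\overline\Delta,$$ where $C_j(\xi)$ stands in the $j$-th position and $$C_j(\xi)=\begin{cases}\{\xi_j\}&\text{if }|\xi_j|=1,\\ \partial\Delta&\text{if }|\xi_j|<1.\end{cases}$$ -/

import Mathlib

open scoped ENNReal

noncomputable section

/-- The Poincaré distance of the unit disk `Δ ⊂ ℂ`: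
`k_Δ(ζ, η) = ½ log ((1 + ρ) / (1 - ρ))` with `ρ = |(η - ζ) / (1 - conj ζ * η)|`.
Only used at points of the open unit disk, where `ρ < 1`. -/
def poincareDist (ζ η : ℂ) : ℝ :=
  (1 / 2) * Real.log
    ((1 + ‖(η - ζ) / (1 - (starRingEnd ℂ) ζ * η)‖) /
      (1 - ‖(η - ζ) / (1 - (starRingEnd ℂ) ζ * η)‖))

/-- The Lempert function of a subset `D` of a complex normed space: the infimum of `k_Δ(ζ, η)` over
all holomorphic maps `φ : Δ → D` with `φ ζ = z` and `φ η = w` (it is `∞` if there is none). -/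
def lempert {E : Type*} [NormedAddCommGroup E] [NormedSpace ℂ E] (D : Set E) (z w : E) : ℝ≥0∞ :=
  sInf {r | ∃ (φ : ℂ → E) (ζ η : ℂ),
    DifferentiableOn ℂ φ (Metric.ball 0 1) ∧ Set.MapsTo φ (Metric.ball 0 1) D ∧
    ζ ∈ Metric.ball (0 : ℂ) 1 ∧ η ∈ Metric.ball (0 : ℂ) 1 ∧ φ ζ = z ∧ φ η = w ∧
    r = ENNReal.ofReal (poincareDist ζ η)}

/-- `d` is an (extended) pseudodistance on the set `D`. -/
structure IsPseudoDistOn {E : Type*} (D : Set E) (d : E → E → ℝ≥0∞) : Prop where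
  self : ∀ z ∈ D, d z z = 0
  symm : ∀ z ∈ D, ∀ w ∈ D, d z w = d w z
  triangle : ∀ x ∈ D, ∀ y ∈ D, ∀ z ∈ D, d x z ≤ d x y + d y z

/-- The Kobayashi pseudodistance of `D`: the largest pseudodistance on `D` that is bounded above by
the Lempert function of `D`. -/
def kobayashi {E : Type*} [NormedAddCommGroup E] [NormedSpace ℂ E] (D : Set E) (z w : E) : ℝ≥0∞ :=
  sSup {r | ∃ d : E → E → ℝ≥0∞, IsPseudoDistOn D d ∧
    (∀ x ∈ D, ∀ y ∈ D, d x y ≤ lempert D x y) ∧ r = d z w}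

/-- `f` does not increase the Kobayashi pseudodistance of `D`. -/
def KobayashiNonexpansiveOn {E : Type*} [NormedAddCommGroup E] [NormedSpace ℂ E]
    (f : E → E) (D : Set E) : Prop :=
  ∀ z ∈ D, ∀ w ∈ D, kobayashi D (f z) (f w) ≤ kobayashi D z w

/-- `h` is a limit point of the iterates of `f` on `D`: some subsequence of the iterates converges
to `h` uniformly on compact subsets of `D`. -/
def IsIterateLimit {E : Type*} [NormedAddCommGroup E] (f : E → E) (D : Set E) (h : E → E) : Prop :=
  ∃ κ : ℕ → ℕ, StrictMono κ ∧
    ∀ K ⊆ D, IsCompact K → TendstoUniformlyOn (fun j => f^[κ j]) h Filter.atTop K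

/-- The target set `T(f)` of a self-map `f` of `D`: the union of the images `h(D)` of the limit
points `h` of the sequence of iterates. -/
def targetSet {E : Type*} [NormedAddCommGroup E] (f : E → E) (D : Set E) : Set E :=
  ⋃ h ∈ {h : E → E | IsIterateLimit f D h}, h '' D

/-- The polydisk `Δⁿ`: the open unit ball of `ℂⁿ` for the maximum norm. -/
def polydisk (n : ℕ) : Set (Fin n → ℂ) := Metric.ball 0 1

/-- `C_j(ξ)` is `{ξ_j}` if `|ξ_j| = 1`, and the unit circle otherwise. -/
def boundaryFactor {n : ℕ} (ξ : Fin n → ℂ) (j : Fin n) : Set ℂ :=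
  if ‖ξ j‖ = 1 then {ξ j} else Metric.sphere 0 1

end

/-!
The Cayley transform in each coordinate identifies `Δⁿ` and twice its Kobayashi distance with `ℍⁿ`
and the maximum of the hyperbolic distances, so that `f` becomes a nonexpansive self-map `g` of a
proper metric space. The homotheties `z ↦ r * z` of `Δⁿ` strictly decrease distances, have bounded
ranges and preserve the balls containing the origin. Their compositions with `g` therefore have
fixed points `x m`, where `r = r m` increases to `1`.

A cluster point of `x` would be a fixed point of `g`, and a cluster point in `Δⁿ` of an orbit would
give rise to a fixed point too, by Całka's theorem. Hence `x m` tends to the boundary, all cluster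
points of orbits lie on the boundary, and `d (g^k a) (x m) ≤ d a (x m) + o(1)`. Along a
subsequence, the coordinate of `x m` of largest modulus is always the `j`-th and tends to some `c`
on the unit circle; the distances to `x m` being controlled by this coordinate, the `j`-th
coordinates of each orbit are confined to a horodisk at `c`.
So `ξ = c e_j` works: a cluster point whose `j`-th coordinate lies on the circle has `c` there.
-/

open Bornology Filter Metric Set Topology
open scoped ComplexConjugate UpperHalfPlane

/-! ### Nonexpansive maps of proper metric spaces -/

section Nonexpansive

/-- **Edelstein's theorem**. -/
theorem exists_isFixedPt_of_isCompact_of_dist_lt {X : Type*} [MetricSpace X] {T : X → X}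
    {K : Set X} (hK : IsCompact K) (hne : K.Nonempty) (hm : MapsTo T K K)
    (hT : ∀ x ∈ K, ∀ y ∈ K, x ≠ y → dist (T x) (T y) < dist x y) :
    ∃ x ∈ K, Function.IsFixedPt T x := by
  have hTc : ContinuousOn T K := by
    refine (LipschitzOnWith.of_dist_le_mul (K := 1) fun x hx y hy => ?_).continuousOn
    rcases eq_or_ne x y with rfl | hxy
    · simp
    · simpa using (hT x hx y hy hxy).le
  obtain ⟨x, hx, hmin⟩ := hK.exists_isMinOn hne
    (continuous_dist.comp_continuousOn (hTc.prodMk continuousOn_id))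
  exact ⟨x, hx, by_contra fun h => (hT _ (hm hx) _ hx h).not_ge (hmin (hm hx))⟩

/-- **Całka's theorem**. -/
theorem exists_isCompact_mapsTo_of_mapClusterPt {X : Type*} [PseudoMetricSpace X] [ProperSpace X]
    {g : X → X} (hg : LipschitzWith 1 g) {x y : X} (hy : MapClusterPt y atTop (g^[·] x)) :
    ∃ B : Set X, IsCompact B ∧ B.Nonempty ∧ MapsTo g B B := by
  have hdist (k : ℕ) (p q : X) : dist (g^[k] p) (g^[k] q) ≤ dist p q := by
    simpa using (hg.iterate k).dist_le_mul p q
  set O : Set X := closure (range (g^[·] x))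
  have hgO : MapsTo g O O := by
    refine MapsTo.closure ?_ hg.continuous
    rintro _ ⟨k, rfl⟩
    exact ⟨k + 1, Function.iterate_succ_apply' g k x⟩
  have hyO : y ∈ O := isClosed_closure.mem_of_mapClusterPt hy
    (.of_forall fun k => subset_closure (mem_range_self k))
  have hreturn : ∀ p ∈ O, ∃ m, dist (g^[m + 1] p) y < 1 := by
    intro p hp
    obtain ⟨k, hk⟩ := mem_closure_range_iff.1 hp _ one_half_pos
    obtain ⟨l, hkl, hl⟩ := frequently_atTop.1 (hy.frequently (ball_mem_nhds y one_half_pos)) (k + 1)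
    obtain ⟨m, rfl⟩ := Nat.exists_eq_add_of_le' hkl
    rw [← add_assoc, add_right_comm, Function.iterate_add_apply] at hl
    refine ⟨m, ?_⟩
    linarith [dist_triangle (g^[m + 1] p) (g^[m + 1] (g^[k] x)) y, hdist (m + 1) p (g^[k] x)]
  set A : Set X := O ∩ closedBall y 1
  have hA : IsCompact A := (isCompact_closedBall y 1).inter_left isClosed_closure
  obtain ⟨t, ht⟩ := hA.elim_finite_subcover (fun m => {p | dist (g^[m + 1] p) y < (1 : ℝ)})
    (fun m => isOpen_lt ((hg.continuous.iterate _).dist continuous_const) continuous_const)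
    fun p hp => mem_iUnion.2 (hreturn p hp.1)
  refine ⟨⋃ m ∈ Iic (t.sup id), g^[m] '' A,
    (finite_Iic _).isCompact_biUnion fun m _ => hA.image (hg.continuous.iterate m),
    ⟨y, mem_biUnion (Nat.zero_le _) ⟨y, ⟨hyO, mem_closedBall_self zero_le_one⟩, rfl⟩⟩, ?_⟩
  rintro _ hp
  obtain ⟨m, hm, p, hpA, rfl⟩ := mem_iUnion₂.1 hp
  rw [← Function.iterate_succ_apply' g m p]
  rcases (mem_Iic.1 hm).lt_or_eq with hlt | rfl
  · exact mem_biUnion (Nat.succ_le_of_lt hlt) ⟨p, hpA, rfl⟩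
  · obtain ⟨i, hi, hip⟩ := mem_iUnion₂.1 (ht hpA)
    have hle : i ≤ t.sup id := Finset.le_sup (f := id) hi
    refine mem_biUnion (Nat.sub_le _ i)
      ⟨g^[i + 1] p, ⟨hgO.iterate _ hpA.1, ball_subset_closedBall hip⟩, ?_⟩
    rw [← Function.iterate_add_apply, ← add_assoc, Nat.sub_add_cancel hle]

variable {X : Type*} [MetricSpace X]

/-- A sequence of self-maps modelled on the homotheties `z ↦ r m • z`, `r m ↑ 1`, of a ball with
its hyperbolic distance: they strictly decrease distances, have bounded ranges, converge to the
identity, and preserve the closed balls that contain the base point `o`. -/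
structure IsShrinking (o : X) (s : ℕ → X → X) : Prop where
  dist_lt : ∀ m x y, x ≠ y → dist (s m x) (s m y) < dist x y
  isBounded_range : ∀ m, IsBounded (range (s m))
  tendsto : ∀ x, Tendsto (s · x) atTop (𝓝 x)
  mapsTo_closedBall : ∀ m c ρ, o ∈ closedBall c ρ → MapsTo (s m) (closedBall c ρ) (closedBall c ρ)

namespace IsShrinking

variable {o : X} {s : ℕ → X → X} {g : X → X}

theorem lipschitzWith (hs : IsShrinking o s) (m : ℕ) : LipschitzWith 1 (s m) := by
  refine LipschitzWith.mk_one fun x y => ?_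
  rcases eq_or_ne x y with rfl | hxy
  · simp
  · exact (hs.dist_lt m x y hxy).le

theorem lipschitzWith_comp (hs : IsShrinking o s) (hg : LipschitzWith 1 g) (m : ℕ) :
    LipschitzWith 1 (s m ∘ g) := by
  simpa using (hs.lipschitzWith m).comp hg

theorem dist_comp_le (hs : IsShrinking o s) (hg : LipschitzWith 1 g) {m : ℕ} {x : X}
    (hx : s m (g x) = x) (a : X) : dist (s m (g a)) x ≤ dist a x := by
  simpa [hx] using (hs.lipschitzWith_comp hg m).dist_le_mul a x

theorem pi {ι : Type*} [Fintype ι] (hs : IsShrinking o s) :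
    IsShrinking (fun _ : ι => o) fun m x j => s m (x j) where
  dist_lt m x y hxy := by
    refine (dist_pi_lt_iff (dist_pos.2 hxy)).2 fun j => ?_
    rcases eq_or_ne (x j) (y j) with hj | hj
    · simpa only [hj, dist_self] using dist_pos.2 hxy
    · exact (hs.dist_lt m _ _ hj).trans_le (dist_le_pi_dist x y j)
  isBounded_range m := by
    refine (IsBounded.pi fun _ : ι => hs.isBounded_range m).subset ?_
    rintro _ ⟨x, rfl⟩ j -
    exact mem_range_self (x j)
  tendsto x := tendsto_pi_nhds.2 fun j => hs.tendsto (x j)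
  mapsTo_closedBall m c ρ ho x hx := by
    have hρ : 0 ≤ ρ := dist_nonneg.trans ho
    rw [mem_closedBall, dist_pi_le_iff hρ] at ho hx ⊢
    exact fun j => hs.mapsTo_closedBall m (c j) ρ (ho j) (hx j)

theorem exists_isFixedPt_comp (hs : IsShrinking o s) (hg : LipschitzWith 1 g) {m : ℕ} {K : Set X}
    (hK : IsCompact K) (hne : K.Nonempty) (hm : MapsTo (s m ∘ g) K K) :
    ∃ x ∈ K, s m (g x) = x := by
  refine exists_isFixedPt_of_isCompact_of_dist_lt hK hne hm fun x _ y _ hxy => ?_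
  rcases eq_or_ne (g x) (g y) with h | h
  · simpa [h] using hxy
  · exact (hs.dist_lt m _ _ h).trans_le (by simpa using hg.dist_le_mul x y)

theorem isFixedPt_of_mapClusterPt (hs : IsShrinking o s) (hg : LipschitzWith 1 g) {x : ℕ → X}
    (hx : ∀ m, s m (g (x m)) = x m) {p : X} (hp : MapClusterPt p atTop x) :
    Function.IsFixedPt g p := by
  refine eq_of_forall_dist_le fun ε hε => ?_
  have hε' : 0 < ε / 3 := by positivity
  obtain ⟨m, hxm, hsm⟩ := ((hp.frequently (ball_mem_nhds p hε')).and_eventually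
    ((hs.tendsto (g p)).eventually (ball_mem_nhds _ hε'))).exists
  rw [dist_comm] at hxm hsm
  linarith [dist_triangle4_right (g p) p (s m (g p)) (x m), hs.dist_comp_le hg (hx m) p]

theorem exists_isFixedPt_of_mapsTo_isCompact [ProperSpace X] (hs : IsShrinking o s)
    (hg : LipschitzWith 1 g) {B : Set X} (hB : IsCompact B) (hne : B.Nonempty)
    (hgB : MapsTo g B B) : ∃ p, Function.IsFixedPt g p := by
  obtain ⟨x, hx⟩ := hne
  obtain ⟨R, hR⟩ := hB.isBounded.subset_closedBall o
  have horbit (k : ℕ) : dist (g^[k] x) o ≤ R := hR (hgB.iterate k hx)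
  -- The points asymptotically within `R` of the orbit form a set invariant under `g` and all `s m`.
  set K : Set X := {y | ∀ᶠ k in atTop, dist y (g^[k] x) ≤ R}
  have hoK : o ∈ K := .of_forall fun k => by simpa [dist_comm] using horbit k
  have hK : IsCompact (closure K) := by
    refine (isBounded_closedBall (x := o) (r := R + R)).subset (fun y hy => ?_)
      |>.isCompact_closure
    obtain ⟨k, hk⟩ := Eventually.exists hy
    exact (dist_triangle y (g^[k] x) o).trans (add_le_add hk (horbit k))
  have hgK : MapsTo g K K := fun y hy => by
    rw [mem_ofPred_eq, ← map_add_atTop_eq_nat 1, eventually_map]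
    filter_upwards [hy] with k hk
    rw [Function.iterate_succ_apply']
    exact (hg.dist_le_mul _ _).trans (by simpa using hk)
  have hsK (m : ℕ) : MapsTo (s m) K K := fun y hy => hy.mono fun k hk =>
    hs.mapsTo_closedBall m (g^[k] x) R (by simpa [dist_comm] using horbit k) hk
  choose z hzK hz using fun m : ℕ => hs.exists_isFixedPt_comp hg hK ⟨o, subset_closure hoK⟩
    (((hsK m).comp hgK).closure (hs.lipschitzWith_comp hg m).continuous)
  obtain ⟨p, -, hp⟩ := hK.exists_mapClusterPt (f := atTop) (u := z)
    (tendsto_principal.2 (.of_forall hzK))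
  exact ⟨p, hs.isFixedPt_of_mapClusterPt hg hz hp⟩

theorem exists_isFixedPt_of_mapClusterPt_iterate [ProperSpace X] (hs : IsShrinking o s)
    (hg : LipschitzWith 1 g) {x y : X} (hy : MapClusterPt y atTop (g^[·] x)) :
    ∃ p, Function.IsFixedPt g p :=
  let ⟨_, hB, hne, hgB⟩ := exists_isCompact_mapsTo_of_mapClusterPt hg hy
  hs.exists_isFixedPt_of_mapsTo_isCompact hg hB hne hgB

theorem dist_iterate_le_add_sum (hs : IsShrinking o s) (hg : LipschitzWith 1 g) {m : ℕ} {x : X}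
    (hx : s m (g x) = x) (a : X) (k : ℕ) :
    dist (g^[k] a) x ≤
      dist a x + ∑ i ∈ Finset.range k, dist (s m (g^[i + 1] a)) (g^[i + 1] a) := by
  induction k with
  | zero => simp
  | succ k ih =>
    rw [Finset.sum_range_succ, Function.iterate_succ_apply']
    linarith [dist_triangle_left (g (g^[k] a)) x (s m (g (g^[k] a))),
      hs.dist_comp_le hg hx (g^[k] a)]

/-- A metric form of Wolff's lemma. The points `x m` are the fixed points of `s m ∘ g`. -/
theorem exists_seq_dist_iterate_le [ProperSpace X] (hs : IsShrinking o s) (hg : LipschitzWith 1 g)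
    (hfix : ∀ p, ¬Function.IsFixedPt g p) :
    ∃ x : ℕ → X, (∀ p, ¬MapClusterPt p atTop x) ∧
      ∀ a k, ∀ᶠ m in atTop, dist (g^[k] a) (x m) ≤ dist a (x m) + 1 := by
  choose x _ hx using fun m : ℕ => hs.exists_isFixedPt_comp hg
    (hs.isBounded_range m).isCompact_closure (K := closure (range (s m)))
    ⟨s m o, subset_closure (mem_range_self o)⟩ fun y _ => subset_closure (mem_range_self (g y))
  refine ⟨x, fun p hp => hfix p (hs.isFixedPt_of_mapClusterPt hg hx hp), fun a k => ?_⟩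
  have hsum : Tendsto (fun m => ∑ i ∈ Finset.range k, dist (s m (g^[i + 1] a)) (g^[i + 1] a))
      atTop (𝓝 0) := by
    simpa using tendsto_finsetSum (Finset.range k) fun i _ =>
      tendsto_iff_dist_tendsto_zero.1 (hs.tendsto (g^[i + 1] a))
  filter_upwards [hsum.eventually_le_const one_pos] with m hm
  exact (hs.dist_iterate_le_add_sum hg (hx m) a k).trans (by gcongr)

end IsShrinking

end Nonexpansive

/-! ### The hyperbolic distance of the disk -/

section Disk

theorem coe_add_I_ne_zero (τ : ℍ) : (τ + Complex.I : ℂ) ≠ 0 := fun h => by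
  have him : τ.im + 1 = 0 := by simpa using congrArg Complex.im h
  linarith [τ.im_pos]

theorem one_sub_norm_sub_I_div_add_I_sq (τ : ℍ) :
    1 - ‖(τ - Complex.I) / (τ + Complex.I : ℂ)‖ ^ 2 = 4 * τ.im / ‖(τ + Complex.I : ℂ)‖ ^ 2 := by
  have hτ := norm_ne_zero_iff.2 (coe_add_I_ne_zero τ)
  rw [norm_div, div_pow, eq_div_iff (pow_ne_zero 2 hτ), sub_mul, one_mul,
    div_mul_cancel₀ _ (pow_ne_zero 2 hτ)]
  simp only [Complex.sq_norm, Complex.normSq_apply, Complex.add_re, Complex.add_im, Complex.sub_re,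
    Complex.sub_im, Complex.I_re, Complex.I_im, UpperHalfPlane.coe_im]
  ring

theorem norm_sub_I_div_add_I_lt_one (τ : ℍ) : ‖(τ - Complex.I) / (τ + Complex.I : ℂ)‖ < 1 := by
  have hpos : 0 < 4 * τ.im / ‖(τ + Complex.I : ℂ)‖ ^ 2 := by
    have := norm_pos_iff.2 (coe_add_I_ne_zero τ)
    positivity
  rw [← one_sub_norm_sub_I_div_add_I_sq, sub_pos, sq_lt_one_iff₀ (norm_nonneg _)] at hpos
  exact hpos

theorem one_sub_ne_zero_of_mem_ball {z : ℂ} (hz : z ∈ ball (0 : ℂ) 1) : 1 - z ≠ 0 :=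
  sub_ne_zero.2 fun h => by simp [← h] at hz

theorem im_I_mul_one_add_div_one_sub_pos {z : ℂ} (hz : z ∈ ball (0 : ℂ) 1) :
    0 < (Complex.I * (1 + z) / (1 - z)).im := by
  have him : (Complex.I * (1 + z) / (1 - z)).im = (1 - ‖z‖ ^ 2) / ‖1 - z‖ ^ 2 := by
    simp only [Complex.div_im, Complex.sq_norm, Complex.normSq_apply, Complex.sub_re,
      Complex.sub_im, Complex.mul_re, Complex.mul_im, Complex.add_re, Complex.add_im,
      Complex.one_re, Complex.one_im, Complex.I_re, Complex.I_im]
    ring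
  have hz' := norm_pos_iff.2 (one_sub_ne_zero_of_mem_ball hz)
  rw [mem_ball_zero_iff, ← sq_lt_one_iff₀ (norm_nonneg _), ← sub_pos] at hz
  rw [him]
  positivity

/-- The Cayley transform `τ ↦ (τ - i) / (τ + i)` of the upper half-plane onto the unit disk, used to
transport the hyperbolic distance of `ℍ` to the disk. -/
noncomputable def cayley : OpenPartialHomeomorph ℍ ℂ where
  toFun τ := (τ - Complex.I) / (τ + Complex.I)
  invFun z := UpperHalfPlane.ofComplex (Complex.I * (1 + z) / (1 - z))
  source := univ
  target := ball 0 1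
  map_source' τ _ := mem_ball_zero_iff.2 (norm_sub_I_div_add_I_lt_one τ)
  map_target' _ _ := mem_univ _
  left_inv' τ _ := by
    have hτ := coe_add_I_ne_zero τ
    have hinv : Complex.I * (1 + (τ - Complex.I) / (τ + Complex.I)) /
        (1 - (τ - Complex.I) / (τ + Complex.I)) = (τ : ℂ) := by
      rw [div_eq_iff (one_sub_ne_zero_of_mem_ball
        (mem_ball_zero_iff.2 (norm_sub_I_div_add_I_lt_one τ)))]
      field_simp
      ring
    rw [hinv, UpperHalfPlane.ofComplex_apply]
  right_inv' z hz := by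
    have hτ := coe_add_I_ne_zero (UpperHalfPlane.ofComplex (Complex.I * (1 + z) / (1 - z)))
    have hz' := one_sub_ne_zero_of_mem_ball hz
    rw [div_eq_iff hτ,
      UpperHalfPlane.ofComplex_apply_of_im_pos (im_I_mul_one_add_div_one_sub_pos hz)]
    field_simp
    ring
  open_source := isOpen_univ
  open_target := isOpen_ball
  continuousOn_toFun := ((UpperHalfPlane.continuous_coe.sub continuous_const).div
    (UpperHalfPlane.continuous_coe.add continuous_const) coe_add_I_ne_zero).continuousOn
  continuousOn_invFun := by
    refine UpperHalfPlane.ofComplex.continuousOn.comp (t := UpperHalfPlane.ofComplex.source)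
      (f := fun z => Complex.I * (1 + z) / (1 - z))
      (.div (by fun_prop) (by fun_prop) fun z hz => one_sub_ne_zero_of_mem_ball hz)
      fun z hz => ⟨⟨_, im_I_mul_one_add_div_one_sub_pos hz⟩, mem_univ _, rfl⟩

theorem cayley_apply (τ : ℍ) : cayley τ = (τ - Complex.I) / (τ + Complex.I) := rfl

theorem norm_cayley_lt_one (τ : ℍ) : ‖cayley τ‖ < 1 := norm_sub_I_div_add_I_lt_one τ

theorem one_sub_norm_cayley_sq (τ : ℍ) :
    1 - ‖cayley τ‖ ^ 2 = 4 * τ.im / ‖(τ + Complex.I : ℂ)‖ ^ 2 :=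
  one_sub_norm_sub_I_div_add_I_sq τ

theorem one_sub_norm_cayley_sq_pos (τ : ℍ) : 0 < 1 - ‖cayley τ‖ ^ 2 :=
  sub_pos.2 ((sq_lt_one_iff₀ (norm_nonneg _)).2 (norm_cayley_lt_one τ))

@[simp] theorem cayley_I : cayley UpperHalfPlane.I = 0 := by simp [cayley_apply]

theorem cayley_symm_cayley (τ : ℍ) : cayley.symm (cayley τ) = τ := cayley.left_inv (mem_univ τ)

theorem cayley_injective : Function.Injective cayley :=
  Function.LeftInverse.injective cayley_symm_cayley

theorem exists_cayley_eq {z : ℂ} (hz : z ∈ ball (0 : ℂ) 1) : ∃ τ, cayley τ = z :=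
  ⟨cayley.symm z, cayley.right_inv hz⟩

theorem norm_cayley_sub_cayley (τ σ : ℍ) : ‖cayley τ - cayley σ‖ =
    2 * dist (τ : ℂ) σ / (‖(τ + Complex.I : ℂ)‖ * ‖(σ + Complex.I : ℂ)‖) := by
  have hτ := coe_add_I_ne_zero τ
  have hσ := coe_add_I_ne_zero σ
  have hsub : cayley τ - cayley σ =
      2 * Complex.I * (τ - σ) / ((τ + Complex.I) * (σ + Complex.I)) := by
    rw [cayley_apply, cayley_apply]
    field_simp
    ring
  simp [hsub, dist_eq_norm]

theorem norm_one_sub_conj_cayley_mul_cayley (τ σ : ℍ) : ‖1 - conj (cayley τ) * cayley σ‖ =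
    2 * dist (τ : ℂ) (conj (σ : ℂ)) / (‖(τ + Complex.I : ℂ)‖ * ‖(σ + Complex.I : ℂ)‖) := by
  have hτ : (conj (τ : ℂ) + conj Complex.I) ≠ 0 := by
    simpa only [← map_add, map_ne_zero] using coe_add_I_ne_zero τ
  have hσ := coe_add_I_ne_zero σ
  have hsub : 1 - conj (cayley τ) * cayley σ =
      2 * Complex.I * conj (τ - conj (σ : ℂ)) / (conj (τ + Complex.I) * (σ + Complex.I)) := by
    simp only [cayley_apply, map_sub, map_add, map_div₀, Complex.conj_conj]
    field_simp
    simp only [Complex.conj_I]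
    ring
  rw [hsub, norm_div, norm_mul, norm_mul, norm_mul, Complex.norm_conj, Complex.norm_conj,
    dist_eq_norm]
  simp

theorem sinh_half_dist_sq (τ σ : ℍ) : Real.sinh (dist τ σ / 2) ^ 2 =
    ‖cayley τ - cayley σ‖ ^ 2 / ((1 - ‖cayley τ‖ ^ 2) * (1 - ‖cayley σ‖ ^ 2)) := by
  have hτ := norm_ne_zero_iff.2 (coe_add_I_ne_zero τ)
  have hσ := norm_ne_zero_iff.2 (coe_add_I_ne_zero σ)
  rw [UpperHalfPlane.sinh_half_dist, norm_cayley_sub_cayley, one_sub_norm_cayley_sq,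
    one_sub_norm_cayley_sq, div_pow, mul_pow, Real.sq_sqrt (by positivity)]
  field_simp
  ring

theorem cosh_half_dist_sq (τ σ : ℍ) : Real.cosh (dist τ σ / 2) ^ 2 =
    ‖1 - conj (cayley τ) * cayley σ‖ ^ 2 / ((1 - ‖cayley τ‖ ^ 2) * (1 - ‖cayley σ‖ ^ 2)) := by
  have hτ := norm_ne_zero_iff.2 (coe_add_I_ne_zero τ)
  have hσ := norm_ne_zero_iff.2 (coe_add_I_ne_zero σ)
  rw [UpperHalfPlane.cosh_half_dist, norm_one_sub_conj_cayley_mul_cayley, one_sub_norm_cayley_sq,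
    one_sub_norm_cayley_sq, div_pow, mul_pow, Real.sq_sqrt (by positivity)]
  field_simp
  ring

theorem tanh_half_dist (τ σ : ℍ) : Real.tanh (dist τ σ / 2) =
    ‖(cayley σ - cayley τ) / (1 - conj (cayley τ) * cayley σ)‖ := by
  have hτ := norm_ne_zero_iff.2 (coe_add_I_ne_zero τ)
  have hσ := norm_ne_zero_iff.2 (coe_add_I_ne_zero σ)
  rw [UpperHalfPlane.tanh_half_dist, norm_div, norm_sub_rev, norm_cayley_sub_cayley,
    norm_one_sub_conj_cayley_mul_cayley]
  field_simp

theorem tanh_le_tanh_iff {x y : ℝ} : Real.tanh x ≤ Real.tanh y ↔ x ≤ y := by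
  rw [← Real.artanh_le_artanh_iff ⟨Real.neg_one_lt_tanh x, Real.tanh_lt_one x⟩
    ⟨Real.neg_one_lt_tanh y, Real.tanh_lt_one y⟩, Real.artanh_tanh, Real.artanh_tanh]

theorem dist_I_le_dist_I_iff {τ σ : ℍ} :
    dist UpperHalfPlane.I τ ≤ dist UpperHalfPlane.I σ ↔ ‖cayley τ‖ ≤ ‖cayley σ‖ := by
  rw [← div_le_div_iff_of_pos_right (two_pos (α := ℝ)), ← tanh_le_tanh_iff, tanh_half_dist,
    tanh_half_dist]
  simp

theorem poincareDist_of_norm_eq_tanh {ζ η : ℂ} {d : ℝ}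
    (h : ‖(η - ζ) / (1 - conj ζ * η)‖ = Real.tanh d) : poincareDist ζ η = d := by
  rw [poincareDist, h, ← Real.artanh_eq_half_log ⟨(Real.neg_one_lt_tanh d).le,
    (Real.tanh_lt_one d).le⟩, Real.artanh_tanh]

theorem poincareDist_cayley (τ σ : ℍ) :
    poincareDist (cayley τ) (cayley σ) = dist τ σ / 2 :=
  poincareDist_of_norm_eq_tanh (tanh_half_dist τ σ).symm

/-- Letting `cayley τ` tend to a boundary point confines `cayley σ` to a horodisk at that point. -/
theorem norm_one_sub_conj_cayley_mul_cayley_sq_le {τ σ : ℍ} {R : ℝ} (hR : 0 ≤ R)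
    (h : dist τ σ ≤ dist UpperHalfPlane.I τ + R) :
    ‖1 - conj (cayley τ) * cayley σ‖ ^ 2 ≤ Real.exp R * (1 - ‖cayley σ‖ ^ 2) := by
  have hcosh : Real.cosh (dist τ σ / 2) ≤
      Real.exp (R / 2) * Real.cosh (dist UpperHalfPlane.I τ / 2) := by
    calc Real.cosh (dist τ σ / 2)
      _ ≤ Real.cosh (R / 2 + dist UpperHalfPlane.I τ / 2) := by
        rw [Real.cosh_le_cosh, abs_of_nonneg (by positivity), abs_of_nonneg (by positivity)]
        linarith
      _ ≤ Real.exp (R / 2) * Real.cosh (dist UpperHalfPlane.I τ / 2) := by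
        rw [Real.cosh_add, ← Real.cosh_add_sinh, add_mul]
        gcongr
        exact (Real.sinh_lt_cosh _).le
  have hsq := pow_le_pow_left₀ (Real.cosh_pos _).le hcosh 2
  have hτ := one_sub_norm_cayley_sq_pos τ
  have hσ := one_sub_norm_cayley_sq_pos σ
  rw [mul_pow, ← Real.exp_nat_mul, cosh_half_dist_sq, cosh_half_dist_sq, cayley_I,
    div_le_iff₀ (by positivity)] at hsq
  refine hsq.trans_eq ?_
  have hexp : ((2 : ℕ) : ℝ) * (R / 2) = R := by push_cast; ring
  rw [hexp]
  simp only [map_zero, zero_mul, sub_zero, norm_one, norm_zero, one_pow, zero_pow two_ne_zero,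
    one_mul]
  field_simp

/-- The homothety `z ↦ r * z` of the unit disk, read in the upper half-plane. -/
noncomputable def shrink (r : ℝ) (τ : ℍ) : ℍ := cayley.symm (r * cayley τ)

theorem norm_ofReal_mul_cayley_lt_one {r : ℝ} (hr : r ∈ Ioo (0 : ℝ) 1) (τ : ℍ) :
    ‖r * cayley τ‖ < 1 := by
  rw [norm_mul, Complex.norm_real, Real.norm_of_nonneg hr.1.le]
  exact mul_lt_one_of_nonneg_of_lt_one_left hr.1.le hr.2 (norm_cayley_lt_one τ).le

theorem cayley_shrink {r : ℝ} (hr : r ∈ Ioo (0 : ℝ) 1) (τ : ℍ) :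
    cayley (shrink r τ) = r * cayley τ :=
  cayley.right_inv (mem_ball_zero_iff.2 (norm_ofReal_mul_cayley_lt_one hr τ))

theorem norm_cayley_shrink {r : ℝ} (hr : r ∈ Ioo (0 : ℝ) 1) (τ : ℍ) :
    ‖cayley (shrink r τ)‖ = r * ‖cayley τ‖ := by
  rw [cayley_shrink hr, norm_mul, Complex.norm_real, Real.norm_of_nonneg hr.1.le]

theorem sinh_half_sq_lt_sinh_half_sq_iff {x y : ℝ} (hx : 0 ≤ x) (hy : 0 ≤ y) :
    Real.sinh (x / 2) ^ 2 < Real.sinh (y / 2) ^ 2 ↔ x < y := by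
  rw [sq_lt_sq₀ (Real.sinh_nonneg_iff.2 (by positivity)) (Real.sinh_nonneg_iff.2 (by positivity)),
    Real.sinh_lt_sinh, div_lt_div_iff_of_pos_right two_pos]

theorem dist_shrink_lt {r : ℝ} (hr : r ∈ Ioo (0 : ℝ) 1) {τ σ : ℍ} (h : τ ≠ σ) :
    dist (shrink r τ) (shrink r σ) < dist τ σ := by
  have hτ := one_sub_norm_cayley_sq_pos τ
  have hσ := one_sub_norm_cayley_sq_pos σ
  have hpos : 0 < ‖cayley τ - cayley σ‖ := norm_pos_iff.2 (sub_ne_zero.2 (cayley_injective.ne h))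
  have hlt (υ : ℍ) : r * (1 - ‖cayley υ‖ ^ 2) < 1 - (r * ‖cayley υ‖) ^ 2 := by
    nlinarith [mul_nonneg (mul_nonneg hr.1.le (sub_nonneg.2 hr.2.le)) (sq_nonneg ‖cayley υ‖), hr.2]
  have hr0 := hr.1
  rw [← sinh_half_sq_lt_sinh_half_sq_iff dist_nonneg dist_nonneg, sinh_half_dist_sq,
    sinh_half_dist_sq, norm_cayley_shrink hr, norm_cayley_shrink hr, cayley_shrink hr,
    cayley_shrink hr, ← mul_sub, norm_mul, Complex.norm_real,
    Real.norm_of_nonneg hr0.le]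
  calc (r * ‖cayley τ - cayley σ‖) ^ 2 / ((1 - (r * ‖cayley τ‖) ^ 2) * (1 - (r * ‖cayley σ‖) ^ 2))
    _ < (r * ‖cayley τ - cayley σ‖) ^ 2 /
        (r * (1 - ‖cayley τ‖ ^ 2) * (r * (1 - ‖cayley σ‖ ^ 2))) := by
      gcongr
      exacts [hlt τ, hlt σ]
    _ = ‖cayley τ - cayley σ‖ ^ 2 / ((1 - ‖cayley τ‖ ^ 2) * (1 - ‖cayley σ‖ ^ 2)) := by
      field_simp

theorem isBounded_range_shrink {r : ℝ} (hr : r ∈ Ioo (0 : ℝ) 1) : IsBounded (range (shrink r)) := by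
  have hsub : closedBall (0 : ℂ) r ⊆ ball 0 1 := closedBall_subset_ball hr.2
  refine ((isCompact_closedBall (0 : ℂ) r).image_of_continuousOn
    (cayley.continuousOn_symm.mono hsub)).isBounded.subset ?_
  rintro _ ⟨τ, rfl⟩
  refine ⟨r * cayley τ, ?_, rfl⟩
  rw [mem_closedBall_zero_iff, ← cayley_shrink hr, norm_cayley_shrink hr]
  exact mul_le_of_le_one_right hr.1.le (norm_cayley_lt_one τ).le

theorem tendsto_shrink (τ : ℍ) : Tendsto (shrink · τ) (𝓝 1) (𝓝 τ) := by
  have hcont : Continuous fun r : ℝ => (r : ℂ) * cayley τ := by fun_prop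
  exact (cayley.tendsto_symm (mem_univ τ)).comp (hcont.tendsto' 1 _ (by simp))

theorem dist_le_iff_norm_cayley_sub_cayley_sq_le {τ σ : ℍ} {ρ : ℝ} (hρ : 0 ≤ ρ) :
    dist τ σ ≤ ρ ↔ ‖cayley τ - cayley σ‖ ^ 2 ≤
      Real.sinh (ρ / 2) ^ 2 * (1 - ‖cayley τ‖ ^ 2) * (1 - ‖cayley σ‖ ^ 2) := by
  have hτ := one_sub_norm_cayley_sq_pos τ
  have hσ := one_sub_norm_cayley_sq_pos σ
  rw [mul_assoc, ← div_le_iff₀ (by positivity), ← sinh_half_dist_sq, ← not_lt, ← not_lt,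
    sinh_half_sq_lt_sinh_half_sq_iff hρ dist_nonneg]

theorem convex_cayley_image_closedBall (τ : ℍ) (ρ : ℝ) :
    Convex ℝ (cayley '' closedBall τ ρ) := by
  rcases lt_or_ge ρ 0 with hρ | hρ
  · simpa only [closedBall_eq_empty.2 hρ, image_empty] using convex_empty
  set C : ℝ := Real.sinh (ρ / 2) ^ 2 * (1 - ‖cayley τ‖ ^ 2)
  have hC : 0 ≤ C := mul_nonneg (sq_nonneg _) (one_sub_norm_cayley_sq_pos τ).le
  have hmem (σ : ℍ) : σ ∈ closedBall τ ρ ↔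
      dist (cayley σ) (cayley τ) ^ 2 + C * dist (cayley σ) 0 ^ 2 ≤ C := by
    rw [mem_closedBall', dist_le_iff_norm_cayley_sub_cayley_sq_le hρ, dist_zero_right, mul_one_sub,
      le_sub_iff_add_le, dist_eq_norm']
  have himage : cayley '' closedBall τ ρ =
      {z ∈ ball (0 : ℂ) 1 | dist z (cayley τ) ^ 2 + C * dist z 0 ^ 2 ≤ C} := by
    ext z
    constructor
    · rintro ⟨σ, hσ, rfl⟩
      exact ⟨cayley.map_source (mem_univ σ), (hmem σ).1 hσ⟩
    · rintro ⟨hz, hle⟩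
      obtain ⟨σ, rfl⟩ := exists_cayley_eq hz
      exact mem_image_of_mem _ ((hmem σ).2 hle)
  have hsq (w : ℂ) : ConvexOn ℝ (ball (0 : ℂ) 1) fun z => dist z w ^ 2 :=
    (convexOn_dist w (convex_ball 0 1)).pow (fun _ _ => dist_nonneg) 2
  rw [himage]
  exact ((hsq (cayley τ)).add ((hsq 0).smul hC)).convex_le C

theorem mapsTo_shrink_closedBall {r : ℝ} (hr : r ∈ Ioo (0 : ℝ) 1) {τ : ℍ} {ρ : ℝ}
    (h : UpperHalfPlane.I ∈ closedBall τ ρ) :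
    MapsTo (shrink r) (closedBall τ ρ) (closedBall τ ρ) := by
  intro σ hσ
  rw [← cayley_injective.mem_set_image, cayley_shrink hr, ← Complex.real_smul]
  exact (convex_cayley_image_closedBall τ ρ).smul_mem_of_zero_mem
    ⟨_, h, cayley_I⟩ (mem_image_of_mem _ hσ) ⟨hr.1.le, hr.2.le⟩

theorem isShrinking_shrink {r : ℕ → ℝ} (hr : ∀ m, r m ∈ Ioo (0 : ℝ) 1)
    (hr1 : Tendsto r atTop (𝓝 1)) : IsShrinking UpperHalfPlane.I fun m => shrink (r m) where
  dist_lt m _ _ h := dist_shrink_lt (hr m) h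
  isBounded_range m := isBounded_range_shrink (hr m)
  tendsto τ := (tendsto_shrink τ).comp hr1
  mapsTo_closedBall m _ _ h := mapsTo_shrink_closedBall (hr m) h

theorem exists_isShrinking_upperHalfPlane : ∃ s, IsShrinking UpperHalfPlane.I s :=
  let ⟨_, _, hr, hr1⟩ := exists_seq_strictMono_tendsto' (zero_lt_one (α := ℝ))
  ⟨_, isShrinking_shrink hr hr1⟩

/-- The automorphism of the unit disk that takes `0` to `a`, with inverse `diskAut (-a)`. -/
noncomputable def diskAut (a ζ : ℂ) : ℂ := (ζ + a) / (1 + conj a * ζ)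

theorem one_add_conj_mul_ne_zero {a ζ : ℂ} (ha : ‖a‖ < 1) (hζ : ‖ζ‖ < 1) :
    1 + conj a * ζ ≠ 0 := fun h => by
  have hnorm : ‖conj a * ζ‖ = 1 := by rw [← norm_neg, ← eq_neg_of_add_eq_zero_left h, norm_one]
  rw [norm_mul, Complex.norm_conj] at hnorm
  exact (mul_lt_one_of_nonneg_of_lt_one_left (norm_nonneg a) ha hζ.le).ne hnorm

theorem diskAut_zero (a : ℂ) : diskAut a 0 = a := by simp [diskAut]

theorem diskAut_neg_self (a : ℂ) : diskAut (-a) a = 0 := by simp [diskAut]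

theorem norm_diskAut_neg_cayley (τ σ : ℍ) :
    ‖diskAut (-cayley τ) (cayley σ)‖ = Real.tanh (dist τ σ / 2) := by
  simp only [tanh_half_dist, diskAut, map_neg, neg_mul, sub_eq_add_neg]

theorem norm_diskAut_lt_one {a ζ : ℂ} (ha : ‖a‖ < 1) (hζ : ‖ζ‖ < 1) : ‖diskAut a ζ‖ < 1 := by
  obtain ⟨τ, hτ⟩ := exists_cayley_eq (z := -a) (by simpa)
  obtain ⟨σ, rfl⟩ := exists_cayley_eq (mem_ball_zero_iff.2 hζ)
  rw [← neg_neg a, ← hτ, norm_diskAut_neg_cayley]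
  exact Real.tanh_lt_one _

theorem mapsTo_diskAut {a : ℂ} (ha : ‖a‖ < 1) : MapsTo (diskAut a) (ball 0 1) (ball 0 1) :=
  fun _ hζ => mem_ball_zero_iff.2 (norm_diskAut_lt_one ha (mem_ball_zero_iff.1 hζ))

theorem differentiableOn_diskAut {a : ℂ} (ha : ‖a‖ < 1) :
    DifferentiableOn ℂ (diskAut a) (ball 0 1) :=
  .div (by fun_prop) (by fun_prop) fun _ hζ =>
    one_add_conj_mul_ne_zero ha (mem_ball_zero_iff.1 hζ)

theorem diskAut_diskAut_neg {a ζ : ℂ} (ha : ‖a‖ < 1) (hζ : ‖ζ‖ < 1) :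
    diskAut a (diskAut (-a) ζ) = ζ := by
  have ha' : ‖-a‖ < 1 := by rwa [norm_neg]
  have hne := one_add_conj_mul_ne_zero ha' hζ
  have hne' := one_add_conj_mul_ne_zero ha (norm_diskAut_lt_one ha' hζ)
  rw [diskAut, div_eq_iff hne', diskAut]
  rw [map_neg] at hne ⊢
  linear_combination div_mul_cancel₀ (ζ + -a) hne

/-- The **Schwarz–Pick lemma**. -/
theorem dist_le_dist_of_differentiableOn_of_mapsTo_ball {φ : ℂ → ℂ}
    (hd : DifferentiableOn ℂ φ (ball 0 1)) (hm : MapsTo φ (ball 0 1) (ball 0 1)) {τ σ τ' σ' : ℍ}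
    (hτ : φ (cayley τ) = cayley τ') (hσ : φ (cayley σ) = cayley σ') : dist τ' σ' ≤ dist τ σ := by
  have ha := norm_cayley_lt_one τ
  have hb : ‖-cayley τ'‖ < 1 := by simpa using norm_cayley_lt_one τ'
  let ψ : ℂ → ℂ := diskAut (-cayley τ') ∘ φ ∘ diskAut (cayley τ)
  have hψd : DifferentiableOn ℂ ψ (ball 0 1) :=
    (differentiableOn_diskAut hb).comp (hd.comp (differentiableOn_diskAut ha) (mapsTo_diskAut ha))
      (hm.comp (mapsTo_diskAut ha))
  have hψm : MapsTo ψ (ball 0 1) (closedBall 0 1) :=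
    ((mapsTo_diskAut hb).comp (hm.comp (mapsTo_diskAut ha))).mono_right ball_subset_closedBall
  have hψ0 : ψ 0 = 0 := by
    simp only [ψ, Function.comp_apply, diskAut_zero, hτ, diskAut_neg_self]
  have hσ1 : ‖diskAut (-cayley τ) (cayley σ)‖ < 1 :=
    norm_diskAut_lt_one (by simpa using ha) (norm_cayley_lt_one σ)
  have hschwarz := Complex.norm_le_norm_of_mapsTo_ball hψd hψm hψ0 hσ1
  simp only [ψ, Function.comp_apply, diskAut_diskAut_neg ha (norm_cayley_lt_one σ), hσ,
    norm_diskAut_neg_cayley, tanh_le_tanh_iff] at hschwarz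
  linarith

/-- The converse of the Schwarz–Pick lemma: a homothety followed by the automorphism of the disk
that moves `0` to `cayley τ`. -/
theorem exists_differentiableOn_mapsTo_ball_of_half_dist_le {τ σ : ℍ} {d : ℝ}
    (h : dist τ σ / 2 ≤ d) : ∃ φ : ℂ → ℂ, DifferentiableOn ℂ φ (ball 0 1) ∧
      MapsTo φ (ball 0 1) (ball 0 1) ∧ φ 0 = cayley τ ∧ φ (Real.tanh d) = cayley σ := by
  set u : ℂ := diskAut (-cayley τ) (cayley σ) with hu
  have hut : ‖u‖ ≤ Real.tanh d := by rwa [hu, norm_diskAut_neg_cayley, tanh_le_tanh_iff]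
  have ht : 0 ≤ Real.tanh d := (norm_nonneg u).trans hut
  have hmul_div : Real.tanh d * (u / Real.tanh d) = u := mul_div_cancel_of_imp' fun h0 =>
    norm_le_zero_iff.1 (hut.trans_eq (Complex.ofReal_eq_zero.1 h0))
  have hle : ‖u / Real.tanh d‖ ≤ 1 := by
    rw [norm_div, Complex.norm_real, Real.norm_of_nonneg ht]
    exact div_le_one_of_le₀ hut ht
  have hscale : MapsTo (fun ζ => ζ * (u / Real.tanh d)) (ball 0 1) (ball 0 1) := fun ζ hζ => by
    rw [mem_ball_zero_iff] at hζ ⊢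
    exact (norm_mul_le _ _).trans_lt (mul_lt_one_of_nonneg_of_lt_one_left (norm_nonneg ζ) hζ hle)
  have ha := norm_cayley_lt_one τ
  refine ⟨fun ζ => diskAut (cayley τ) (ζ * (u / Real.tanh d)),
    (differentiableOn_diskAut ha).comp (by fun_prop) hscale, (mapsTo_diskAut ha).comp hscale,
    ?_, ?_⟩
  · simp only [zero_mul, diskAut_zero]
  · exact (congrArg (diskAut _) hmul_div).trans (diskAut_diskAut_neg ha (norm_cayley_lt_one σ))

end Disk

/-! ### The Kobayashi distance of the polydisk -/

section Kobayashi

variable {E : Type*} [NormedAddCommGroup E] [NormedSpace ℂ E] {D : Set E}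

theorem kobayashi_eq_lempert (h : IsPseudoDistOn D (lempert D)) {z w : E} (hz : z ∈ D)
    (hw : w ∈ D) : kobayashi D z w = lempert D z w := by
  refine le_antisymm (sSup_le ?_) (le_sSup ⟨lempert D, h, fun _ _ _ _ => le_rfl, rfl⟩)
  rintro _ ⟨d, -, hd, rfl⟩
  exact hd z hz w hw

theorem lempert_le_of_differentiableOn {f : E → E} (hd : DifferentiableOn ℂ f D) (hm : MapsTo f D D)
    (z w : E) : lempert D (f z) (f w) ≤ lempert D z w := by
  refine le_sInf ?_
  rintro _ ⟨φ, ζ, η, hφ, hφm, hζ, hη, rfl, rfl, rfl⟩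
  exact sInf_le ⟨f ∘ φ, ζ, η, hd.comp hφ hφm, hm.comp hφm, hζ, hη, rfl, rfl, rfl⟩

theorem kobayashiNonexpansiveOn_of_differentiableOn {f : E → E} (hd : DifferentiableOn ℂ f D)
    (hm : MapsTo f D D) : KobayashiNonexpansiveOn f D := by
  intro z _ w _
  refine sSup_le ?_
  rintro _ ⟨d, hpd, hdl, rfl⟩
  exact le_sSup ⟨fun x y => d (f x) (f y),
    ⟨fun x hx => hpd.self _ (hm hx), fun x hx y hy => hpd.symm _ (hm hx) _ (hm hy),
      fun x hx y hy u hu => hpd.triangle _ (hm hx) _ (hm hy) _ (hm hu)⟩,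
    fun x hx y hy => (hdl _ (hm hx) _ (hm hy)).trans (lempert_le_of_differentiableOn hd hm x y),
    rfl⟩

end Kobayashi

section Polydisk

variable {ι : Type*} [Fintype ι]

/-- The coordinatewise Cayley transform of `ℍ^ι` onto the polydisk, which turns the maximum distance
of `ℍ^ι` into twice the Kobayashi distance. -/
noncomputable def polyCayley (ι : Type*) [Fintype ι] : OpenPartialHomeomorph (ι → ℍ) (ι → ℂ) :=
  .pi fun _ => cayley

theorem polyCayley_source : (polyCayley ι).source = univ := pi_univ univ

theorem polyCayley_target : (polyCayley ι).target = ball 0 1 := ball_pi _ one_pos |>.symm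

theorem polyCayley_mem_ball (τ : ι → ℍ) : polyCayley ι τ ∈ ball 0 1 :=
  polyCayley_target (ι := ι) ▸ (polyCayley ι).map_source (polyCayley_source (ι := ι) ▸ mem_univ τ)

theorem exists_polyCayley_eq {z : ι → ℂ} (hz : z ∈ ball 0 1) : ∃ τ, polyCayley ι τ = z :=
  ⟨(polyCayley ι).symm z, (polyCayley ι).right_inv (polyCayley_target (ι := ι).symm ▸ hz)⟩

theorem isOpenEmbedding_polyCayley : IsOpenEmbedding (polyCayley ι) :=
  (polyCayley ι).isOpenEmbedding polyCayley_source

theorem le_lempert_polyCayley (τ σ : ι → ℍ) :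
    ENNReal.ofReal (dist τ σ / 2) ≤ lempert (ball 0 1) (polyCayley ι τ) (polyCayley ι σ) := by
  refine le_sInf ?_
  rintro _ ⟨φ, ζ, η, hφ, hφm, hζ, hη, hφζ, hφη, rfl⟩
  obtain ⟨α, rfl⟩ := exists_cayley_eq hζ
  obtain ⟨β, rfl⟩ := exists_cayley_eq hη
  rw [poincareDist_cayley]
  gcongr
  refine (dist_pi_le_iff dist_nonneg).2 fun j => ?_
  refine dist_le_dist_of_differentiableOn_of_mapsTo_ball (differentiableOn_pi.1 hφ j)
    (fun x hx => ?_) (congrFun hφζ j) (congrFun hφη j)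
  have hx' := hφm hx
  rw [ball_pi _ one_pos] at hx'
  exact hx' j (mem_univ j)

theorem lempert_polyCayley_le (τ σ : ι → ℍ) :
    lempert (ball 0 1) (polyCayley ι τ) (polyCayley ι σ) ≤ ENNReal.ofReal (dist τ σ / 2) := by
  set d : ℝ := dist τ σ / 2
  choose φ hφ hφm hφ0 hφd using fun j => exists_differentiableOn_mapsTo_ball_of_half_dist_le
    (div_le_div_of_nonneg_right (dist_le_pi_dist τ σ j) zero_le_two)
  have htanh : ‖(Real.tanh d : ℂ)‖ = Real.tanh d := by
    rw [Complex.norm_real, Real.norm_of_nonneg]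
    simpa using tanh_le_tanh_iff.2 (show 0 ≤ d by positivity)
  refine sInf_le ⟨fun ζ j => φ j ζ, 0, Real.tanh d, differentiableOn_pi.2 hφ, fun ζ hζ => ?_,
    mem_ball_self one_pos, ?_, funext hφ0, funext hφd, ?_⟩
  · rw [ball_pi _ one_pos]
    exact fun j _ => hφm j hζ
  · rw [mem_ball_zero_iff, htanh]
    exact Real.tanh_lt_one d
  · rw [poincareDist_of_norm_eq_tanh]
    simpa using htanh

theorem lempert_polyCayley (τ σ : ι → ℍ) :
    lempert (ball 0 1) (polyCayley ι τ) (polyCayley ι σ) = ENNReal.ofReal (dist τ σ / 2) :=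
  le_antisymm (lempert_polyCayley_le τ σ) (le_lempert_polyCayley τ σ)

theorem isPseudoDistOn_lempert_ball : IsPseudoDistOn (ball (0 : ι → ℂ) 1) (lempert (ball 0 1)) where
  self z hz := by
    obtain ⟨τ, rfl⟩ := exists_polyCayley_eq hz
    simp [lempert_polyCayley]
  symm z hz w hw := by
    obtain ⟨τ, rfl⟩ := exists_polyCayley_eq hz
    obtain ⟨σ, rfl⟩ := exists_polyCayley_eq hw
    rw [lempert_polyCayley, lempert_polyCayley, dist_comm]
  triangle x hx y hy z hz := by
    obtain ⟨τ, rfl⟩ := exists_polyCayley_eq hx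
    obtain ⟨σ, rfl⟩ := exists_polyCayley_eq hy
    obtain ⟨υ, rfl⟩ := exists_polyCayley_eq hz
    rw [lempert_polyCayley, lempert_polyCayley, lempert_polyCayley,
      ← ENNReal.ofReal_add (by positivity) (by positivity), ← add_div]
    gcongr
    exact dist_triangle τ σ υ

theorem kobayashi_polyCayley (τ σ : ι → ℍ) :
    kobayashi (ball 0 1) (polyCayley ι τ) (polyCayley ι σ) = ENNReal.ofReal (dist τ σ / 2) := by
  rw [kobayashi_eq_lempert isPseudoDistOn_lempert_ball (polyCayley_mem_ball τ)
    (polyCayley_mem_ball σ), lempert_polyCayley]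

theorem exists_lipschitzWith_semiconj_polyCayley {f : (ι → ℂ) → ι → ℂ}
    (hf : KobayashiNonexpansiveOn f (ball 0 1)) (hm : MapsTo f (ball 0 1) (ball 0 1)) :
    ∃ g : (ι → ℍ) → ι → ℍ, LipschitzWith 1 g ∧ Function.Semiconj (polyCayley ι) g f := by
  choose g hg using fun τ : ι → ℍ => exists_polyCayley_eq (hm (polyCayley_mem_ball τ))
  refine ⟨g, .mk_one fun τ σ => ?_, hg⟩
  have hle := hf _ (polyCayley_mem_ball τ) _ (polyCayley_mem_ball σ)
  rwa [← hg, ← hg, kobayashi_polyCayley, kobayashi_polyCayley,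
    ENNReal.ofReal_le_ofReal_iff (by positivity), div_le_div_iff_of_pos_right two_pos] at hle

/-! ### Iterates of fixed-point-free maps -/

theorem exists_subseq_tendsto_eventually_norm_le {ι : Type*} [Finite ι] [Nonempty ι]
    {E : Type*} [SeminormedAddCommGroup E] [ProperSpace E] {z : ℕ → ι → E}
    (hz : IsBounded (range z)) :
    ∃ (p : ι → E) (j : ι) (κ : ℕ → ℕ), StrictMono κ ∧ Tendsto (fun m => z (κ m)) atTop (𝓝 p) ∧
      ∀ᶠ m in atTop, ∀ l, ‖z (κ m) l‖ ≤ ‖z (κ m) j‖ := by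
  have := Fintype.ofFinite ι
  let _ : TopologicalSpace ι := ⊥
  have : DiscreteTopology ι := ⟨rfl⟩
  choose i hi using fun m => Finite.exists_max fun j => ‖z m j‖
  obtain ⟨⟨p, j⟩, -, κ, hκ, hlim⟩ := (hz.isCompact_closure.prod isCompact_univ).tendsto_subseq
    (x := fun m => (z m, i m)) fun m => ⟨subset_closure (mem_range_self m), mem_univ _⟩
  obtain ⟨hp, hj⟩ := Prod.tendsto_iff _ _ |>.1 hlim
  rw [nhds_discrete, tendsto_pure] at hj
  exact ⟨p, j, κ, hκ, hp, hj.mono fun m (hm : i (κ m) = j) l => hm ▸ hi (κ m) l⟩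

theorem dist_apply_le_dist_I_add {a b x : ι → ℍ} {j : ι} {C : ℝ}
    (hj : ∀ l, ‖cayley (x l)‖ ≤ ‖cayley (x j)‖) (h : dist b x ≤ dist a x + C) :
    dist (x j) (b j) ≤ dist UpperHalfPlane.I (x j) + (dist a (fun _ => UpperHalfPlane.I) + C) := by
  have hcenter : dist (fun _ => UpperHalfPlane.I) x ≤ dist UpperHalfPlane.I (x j) :=
    (dist_pi_le_iff dist_nonneg).2 fun l => dist_I_le_dist_I_iff.2 (hj l)
  rw [dist_comm]
  linarith [dist_le_pi_dist b x j, dist_triangle a (fun _ => UpperHalfPlane.I) x]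

theorem exists_subseq_tendsto_norm_eq_one {ι : Type*} [Finite ι] {x : ℕ → ι → ℍ}
    (hx : ∀ p, ¬MapClusterPt p atTop x) :
    ∃ (j : ι) (c : ℂ) (κ : ℕ → ℕ), ‖c‖ = 1 ∧ StrictMono κ ∧
      Tendsto (fun m => cayley (x (κ m) j)) atTop (𝓝 c) ∧
      ∀ᶠ m in atTop, ∀ l, ‖cayley (x (κ m) l)‖ ≤ ‖cayley (x (κ m) j)‖ := by
  have := Fintype.ofFinite ι
  have : Nonempty ι := not_isEmpty_iff.1 fun _ => hx (x 0)
    (tendsto_const_nhds.congr fun m => Subsingleton.elim (x 0) (x m)).mapClusterPt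
  obtain ⟨p, j, κ, hκ, hp, hmax⟩ := exists_subseq_tendsto_eventually_norm_le
    (z := fun m => polyCayley ι (x m))
    (isBounded_ball.subset (range_subset_iff.2 fun m => polyCayley_mem_ball (x m)))
  have hpj (l : ι) : Tendsto (fun m => cayley (x (κ m) l)) atTop (𝓝 (p l)) := tendsto_pi_nhds.1 hp l
  have hp_notMem : p ∉ ball 0 1 := fun hmem => by
    obtain ⟨τ, rfl⟩ := exists_polyCayley_eq hmem
    exact hx τ (.of_comp hκ.tendsto_atTop
      (isOpenEmbedding_polyCayley.isInducing.tendsto_nhds_iff.2 hp).mapClusterPt)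
  have hp_le (l : ι) : ‖p l‖ ≤ ‖p j‖ :=
    le_of_tendsto_of_tendsto (hpj l).norm (hpj j).norm (hmax.mono fun m hm => hm l)
  have hc : ‖p j‖ = 1 := by
    refine le_antisymm (le_of_tendsto' (hpj j).norm fun m => (norm_cayley_lt_one _).le) ?_
    by_contra! hlt
    exact hp_notMem <| mem_ball_zero_iff.2 <|
      (pi_norm_lt_iff one_pos).2 fun l => (hp_le l).trans_lt hlt
  exact ⟨j, p j, κ, hc, hκ, hpj j, hmax⟩

/-- **Wolff's lemma** for the polydisk: the orbits stay in horodisks in one of the coordinates. -/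
theorem exists_norm_one_sub_conj_mul_iterate_sq_le {g : (ι → ℍ) → ι → ℍ} (hg : LipschitzWith 1 g)
    (hfix : ∀ p, ¬Function.IsFixedPt g p) :
    ∃ (j : ι) (c : ℂ), ‖c‖ = 1 ∧ ∀ a, ∃ R : ℝ, ∀ k,
      ‖1 - conj c * cayley (g^[k] a j)‖ ^ 2 ≤ R * (1 - ‖cayley (g^[k] a j)‖ ^ 2) := by
  obtain ⟨s, hs⟩ := exists_isShrinking_upperHalfPlane
  obtain ⟨x, hx, hxg⟩ := (hs.pi (ι := ι)).exists_seq_dist_iterate_le hg hfix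
  obtain ⟨j, c, κ, hc, hκ, hxc, hmax⟩ := exists_subseq_tendsto_norm_eq_one hx
  refine ⟨j, c, hc, fun a => ⟨Real.exp (dist a (fun _ => UpperHalfPlane.I) + 1), fun k => ?_⟩⟩
  have hlim : Tendsto (fun m => ‖1 - conj (cayley (x (κ m) j)) * cayley (g^[k] a j)‖ ^ 2)
      atTop (𝓝 (‖1 - conj c * cayley (g^[k] a j)‖ ^ 2)) :=
    ((((Complex.continuous_conj.tendsto c).comp hxc).mul_const _).const_sub 1).norm.pow 2
  refine le_of_tendsto hlim ?_
  filter_upwards [hmax, hκ.tendsto_atTop.eventually (hxg a k)] with m hm hle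
  exact norm_one_sub_conj_cayley_mul_cayley_sq_le (by positivity) (dist_apply_le_dist_I_add hm hle)

theorem eq_of_one_sub_conj_mul_eq_zero {c w : ℂ} (hc : ‖c‖ = 1) (h : 1 - conj c * w = 0) :
    w = c := by
  have hinv : conj c * c = 1 := by rw [Complex.conj_mul', hc, Complex.ofReal_one, one_pow]
  exact mul_left_cancel₀ (left_ne_zero_of_mul_eq_one hinv) ((sub_eq_zero.1 h).symm.trans hinv.symm)

/-- The cluster points of the orbits lie on the boundary, and the horodisks confine those that touch
it in the `j`-th coordinate to the center `c` of the horodisks. -/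
theorem exists_forall_mapClusterPt_iterate {f : (ι → ℂ) → ι → ℂ}
    (hf : KobayashiNonexpansiveOn f (ball 0 1)) (hm : MapsTo f (ball 0 1) (ball 0 1))
    (hfix : ∀ z ∈ ball 0 1, f z ≠ z) :
    ∃ (j : ι) (c : ℂ), ‖c‖ = 1 ∧ ∀ x ∈ ball 0 1, ∀ y, MapClusterPt y atTop (f^[·] x) →
      ‖y‖ = 1 ∧ (‖y j‖ = 1 → y j = c) := by
  obtain ⟨g, hg, hgf⟩ := exists_lipschitzWith_semiconj_polyCayley hf hm
  have hgfix (p : ι → ℍ) : ¬Function.IsFixedPt g p := fun hp =>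
    hfix _ (polyCayley_mem_ball p) (hp.map hgf)
  obtain ⟨j, c, hc, hhoro⟩ := exists_norm_one_sub_conj_mul_iterate_sq_le hg hgfix
  refine ⟨j, c, hc, fun x hx y hy => ?_⟩
  obtain ⟨a, rfl⟩ := exists_polyCayley_eq hx
  have horbit (k : ℕ) : f^[k] (polyCayley ι a) = polyCayley ι (g^[k] a) :=
    ((hgf.iterate_right k) a).symm
  simp only [horbit] at hy
  refine ⟨le_antisymm ?_ ?_, fun hyj => eq_of_one_sub_conj_mul_eq_zero hc ?_⟩
  · exact mem_closedBall_zero_iff.1 <| isClosed_closedBall.mem_of_mapClusterPt hy <|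
      .of_forall fun k => ball_subset_closedBall (polyCayley_mem_ball _)
  · by_contra! hlt
    obtain ⟨b, rfl⟩ := exists_polyCayley_eq (mem_ball_zero_iff.2 hlt)
    have hb : MapClusterPt b atTop (g^[·] a) :=
      isOpenEmbedding_polyCayley.isInducing.mapClusterPt_iff.1 (mapClusterPt_comp.1 hy)
    obtain ⟨s, hs⟩ := exists_isShrinking_upperHalfPlane
    obtain ⟨p, hp⟩ := (hs.pi (ι := ι)).exists_isFixedPt_of_mapClusterPt_iterate hg hb
    exact hgfix p hp
  · obtain ⟨R, hR⟩ := hhoro a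
    have hclosed : IsClosed {w : ι → ℂ | ‖1 - conj c * w j‖ ^ 2 ≤ R * (1 - ‖w j‖ ^ 2)} :=
      isClosed_le (by fun_prop) (by fun_prop)
    have hy_horo : ‖1 - conj c * y j‖ ^ 2 ≤ R * (1 - ‖y j‖ ^ 2) :=
      hclosed.mem_of_mapClusterPt hy (.of_forall hR)
    rwa [hyj, one_pow, sub_self, mul_zero, sq_nonpos_iff, norm_eq_zero] at hy_horo

theorem exists_norm_apply_eq_norm [Nonempty ι] {E : Type*} [SeminormedAddCommGroup E] (y : ι → E) :
    ∃ l, ‖y l‖ = ‖y‖ := by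
  obtain ⟨l, hl⟩ := Finite.exists_max fun j => ‖y j‖
  exact ⟨l, (norm_le_pi_norm y l).antisymm ((pi_norm_le_iff_of_nonneg (norm_nonneg _)).2 hl)⟩

end Polydisk

theorem exists_mapClusterPt_iterate_of_mem_targetSet {E : Type*} [NormedAddCommGroup E] {f : E → E}
    {D : Set E} {y : E} (hy : y ∈ targetSet f D) : ∃ x ∈ D, MapClusterPt y atTop (f^[·] x) := by
  simp only [targetSet, mem_iUnion₂] at hy
  obtain ⟨h, ⟨κ, hκ, hconv⟩, x, hx, rfl⟩ := hy
  exact ⟨x, hx, .of_comp hκ.tendsto_atTop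
    ((hconv {x} (singleton_subset_iff.2 hx) isCompact_singleton).tendsto_at rfl).mapClusterPt⟩

/-- The `j`-th set of the union is the product with `C_j(ξ)` as its `j`-th factor and the closed
unit disk as every other factor. -/
theorem corollary4p1 (n : ℕ) (f : (Fin n → ℂ) → (Fin n → ℂ))
    (hmaps : Set.MapsTo f (polydisk n) (polydisk n))
    (hf : KobayashiNonexpansiveOn f (polydisk n) ∨ DifferentiableOn ℂ f (polydisk n))
    (hfix : ∀ z ∈ polydisk n, f z ≠ z) :
    ∃ ξ ∈ frontier (polydisk n),
      targetSet f (polydisk n) ⊆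
        ⋃ j : Fin n, Set.pi Set.univ
          (Function.update (fun _ : Fin n => Metric.closedBall (0 : ℂ) 1) j
            (boundaryFactor ξ j)) := by
  have hne : KobayashiNonexpansiveOn f (polydisk n) :=
    hf.elim id fun hd => kobayashiNonexpansiveOn_of_differentiableOn hd hmaps
  obtain ⟨j, c, hc, hcluster⟩ := exists_forall_mapClusterPt_iterate hne hmaps hfix
  refine ⟨Pi.single j c, ?_, fun y hy => ?_⟩
  · rw [polydisk, frontier_ball _ one_ne_zero, mem_sphere_zero_iff_norm, Pi.norm_single, hc]
  obtain ⟨x, hx, hxy⟩ := exists_mapClusterPt_iterate_of_mem_targetSet hy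
  obtain ⟨hy1, hyj⟩ := hcluster x hx y hxy
  have : Nonempty (Fin n) := ⟨j⟩
  obtain ⟨l, hl⟩ := exists_norm_apply_eq_norm y
  have hyl : y l ∈ boundaryFactor (Pi.single j c) l := by
    rcases eq_or_ne l j with rfl | hlj
    · simpa [boundaryFactor, hc] using hyj (hl.trans hy1)
    · simpa [boundaryFactor, hlj] using hl.trans hy1
  refine mem_iUnion.2 ⟨l, mem_univ_pi.2 fun q => ?_⟩
  rcases eq_or_ne q l with rfl | hql
  · rwa [Function.update_self]
  · rw [Function.update_of_ne hql, mem_closedBall_zero_iff]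
    exact (norm_le_pi_norm y q).trans_eq hy1
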